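/- Let $n\ge 1$ be an integer and $\mu>0$. Let $A_0,A_1,\dots$ (service times) be nonnegative random variables with common distribution $F_A$ and finite mean $\mathbb E[A]$, and let $B_0,B_1,\dots$ (preparation times) be Erlang-$n$ distributed with parameter $\mu$, i.e. distributed as the sum of $n$ independent exponential random variables with parameter $\mu$; all the $A_k$ and $B_k$ are independent. For a nonnegative initial waiting time $W_0$, the waiting times of the server in the alternating service system are $$W_{k+1}=\max\{0,\,B_{k+1}-A_k-W_k\},\qquad k\ge 0,$$ and $D_k=\sum_{j=0}^{k-1}(W_j+A_j)$ is the time of the $k$-th departure. Then: 1. Whatever the initial waiting time, $W_k$ converges in distribution to one and the same limiting distribution; let $W$ be a random variable with this distribution. It has finite mean $\mathbb E[W]$. 2. Put $\omega(s)=\mathbb E[e^{-sW}]$, $\alpha(s)=\mathbb E[e^{-sA}]$ and $\phi(s)=\omega(s)\alpha(s)$ for $s\ge 0$. Then $\phi$ is infinitely differentiable at $\mu$, and $\alpha$ has a right derivative $\alpha'(0)$ at $0$. 3. There is a number $\theta>0$, the throughput, such that, whatever the initial waiting time, $\lim_{k\to\infty}k/D_k=\theta$ almost surely, and $$\theta^{-1}=\mathbb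 E[W]+\mathbb E[A]=\sum_{i=0}^{n-1}\frac{(-1)^i}{i!}\,\phi^{(i)}(\mu)\,\mu^{i-1}(n-i)-\alpha'(0).$$ -/

import Mathlib

open Filter Topology MeasureTheory ProbabilityTheory

noncomputable section

/-- The Erlang-`n` distribution with rate `r`: the law of the sum of `n` independent
exponential random variables with parameter `r`. -/
def erlangMeasure (n : ℕ) (r : ℝ) : Measure ℝ :=
  Measure.map (fun x : Fin n → ℝ => ∑ j, x j) (Measure.pi fun _ => expMeasure r)

/-- The waiting times of the server, `W_{k+1} = max {0, B_{k+1} - A_k - W_k}`, with initial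
waiting time `W₀`. Customers are numbered from `0`. -/
def waitingTime {Ω : Type*} (A B : ℕ → Ω → ℝ) (W₀ : Ω → ℝ) : ℕ → Ω → ℝ
  | 0 => W₀
  | k + 1 => fun ω => max 0 (B (k + 1) ω - A k ω - waitingTime A B W₀ k ω)

/-- The time of the `k`-th departure: the sum of the waiting and service times of the server
over the first `k` customers. -/
def departureTime {Ω : Type*} (A B : ℕ → Ω → ℝ) (W₀ : Ω → ℝ) (k : ℕ) (ω : Ω) : ℝ :=
  ∑ j ∈ Finset.range k, (waitingTime A B W₀ j ω + A j ω)

/-- An admissible initial waiting time: a nonnegative random variable. -/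
def IsInitialWaitingTime {Ω : Type*} [MeasurableSpace Ω] (P : Measure Ω) (W₀ : Ω → ℝ) : Prop :=
  AEMeasurable W₀ P ∧ ∀ᵐ ω ∂P, 0 ≤ W₀ ω

/-- `ν` is the limiting distribution of the waiting time of the server: whatever the initial
waiting time, `W_k` converges in distribution to `ν`. -/
def IsLimitingWaitingLaw {Ω : Type*} [MeasurableSpace Ω] (P : Measure Ω) [IsProbabilityMeasure P]
    (A B : ℕ → Ω → ℝ) (ν : Measure ℝ) [IsProbabilityMeasure ν] : Prop :=
  ∀ W₀ : Ω → ℝ, IsInitialWaitingTime P W₀ →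
    TendstoInDistribution (waitingTime A B W₀) atTop id (fun _ => P) ν

/-- `θ` is the throughput of the system: whatever the initial waiting time, the number of
departures per unit of time, `k / D_k`, tends to `θ` almost surely. -/
def IsThroughput {Ω : Type*} [MeasurableSpace Ω] (P : Measure Ω)
    (A B : ℕ → Ω → ℝ) (θ : ℝ) : Prop :=
  ∀ W₀ : Ω → ℝ, IsInitialWaitingTime P W₀ →
    ∀ᵐ ω ∂P, Tendsto (fun k : ℕ => (k : ℝ) / departureTime A B W₀ k ω) atTop (𝓝 θ)

/-- The Laplace transform `s ↦ ∫ exp (-s x) dν(x)` of a distribution on `[0, ∞)`. -/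
def laplaceTransform (ν : Measure ℝ) (s : ℝ) : ℝ :=
  ∫ x, Real.exp (-(s * x)) ∂ν

end

/-!
Put `X k = B (k + 1) - A k`; these variables are i.i.d., and the waiting times are obtained by
applying the random antitone maps `u ↦ max 0 (X k - u)` in succession (`waitIter`).

*Loss of memory.* If three consecutive terms satisfy `X k ≤ a`, `2 * a ≤ X (k + 1)`,
`X (k + 2) ≤ a` for some `a ≥ 0`, then the composition of the three maps is identically `0` on `[0, ∞)`. Since an
Erlang variable takes arbitrarily small and arbitrarily large values with positive probability,
such a reset almost surely occurs, even when the service times vanish. Two trajectories therefore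
coincide from some time on (`ae_waitIter_eventually_eq`), whatever the dependence of the initial
value on the `X k`. Applying the same maps in the reversed order (`backIter`) gives variables
with the same laws which are almost surely eventually constant; their limit `V` has the limiting
law of the waiting time, is dominated by `|X 0|`, and satisfies
`E[V] = E[max 0 (X - V)]` with `X` and `V` independent (`integral_backIter_limit_eq`).

*Throughput.* Because the maps are antitone, the waiting time at `j + m` is bounded below, for even
`m`, and above, for odd `m`, by the value reached in `m` steps from `0` at time `j`. The latter is a
function of a window of length `m` of the sequence `X`, for which a strong law holds
(`strong_law_windows`): windows starting in one residue class modulo `m` are independent.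
Letting `m` grow, the Cesàro means of the waiting times converge to `E[V]`
(`ae_tendsto_cesaro_waitIter`).

*The formula for the mean.* For `y ≥ 0` and `B` an Erlang variable,
`E[max 0 (B - y)] = exp (-μ y) * ∑ i < n, (μ y) ^ i / i! * (n - i) / μ`
(`integral_max_sub_erlangMeasure`, by induction on the number of phases). Taking `y = W + A` and
integrating, the terms `E[(W + A) ^ i * exp (-μ (W + A))]` are up to sign the derivatives at `μ` of
the product of the two Laplace transforms (`mean_eq_sum_iteratedDeriv`).
-/

/-! ### The waiting time recursion along a fixed sequence -/

/-- The orbit of `w` under the random maps `u ↦ max 0 (x k - u)`, applied in the order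
`k = 0, 1, 2, …`. -/
def waitIter (x : ℕ → ℝ) (w : ℝ) : ℕ → ℝ
  | 0 => w
  | k + 1 => max 0 (x k - waitIter x w k)

/-- The composition of the first `m` of the maps `u ↦ max 0 (x k - u)` in the reversed order,
`x 0` being applied last, evaluated at `0`. -/
def backIter : ℕ → (ℕ → ℝ) → ℝ
  | 0, _ => 0
  | m + 1, x => max 0 (x 0 - backIter m (fun i => x (i + 1)))

theorem waitIter_nonneg (x : ℕ → ℝ) {w : ℝ} (hw : 0 ≤ w) (k : ℕ) : 0 ≤ waitIter x w k := by
  cases k with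
  | zero => exact hw
  | succ k => exact le_max_left _ _

theorem backIter_nonneg (m : ℕ) (x : ℕ → ℝ) : 0 ≤ backIter m x := by
  cases m with
  | zero => exact le_rfl
  | succ k => exact le_max_left _ _

theorem backIter_le_abs (m : ℕ) (x : ℕ → ℝ) : backIter m x ≤ |x 0| := by
  cases m with
  | zero => exact abs_nonneg _
  | succ k =>
    exact max_le (abs_nonneg _)
      (by linarith [le_abs_self (x 0), backIter_nonneg k fun i => x (i + 1)])

theorem waitIter_add (x : ℕ → ℝ) (w : ℝ) (j m : ℕ) :
    waitIter x w (j + m) = waitIter (fun i => x (i + j)) (waitIter x w j) m := by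
  induction m with
  | zero => rfl
  | succ m ih =>
    rw [← add_assoc, waitIter, waitIter, ih, add_comm j m]

/-- Each map `u ↦ max 0 (x k - u)` is antitone, so an even number of them is monotone and an odd
number is antitone. -/
theorem waitIter_parity (x : ℕ → ℝ) {u w : ℝ} (h : u ≤ w) (m : ℕ) :
    (Even m → waitIter x u m ≤ waitIter x w m) ∧ (Odd m → waitIter x w m ≤ waitIter x u m) := by
  induction m with
  | zero => exact ⟨fun _ => h, fun h => absurd h (by simp)⟩
  | succ m ih =>
    constructor
    · intro he
      have ho : Odd m := by rcases Nat.even_or_odd m with h | h; exacts [absurd he (by grind), h]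
      exact max_le_max le_rfl (sub_le_sub_left (ih.2 ho) _)
    · intro ho
      have he : Even m := by rcases Nat.even_or_odd m with h | h; exacts [h, absurd ho (by grind)]
      exact max_le_max le_rfl (sub_le_sub_left (ih.1 he) _)

theorem waitIter_dependsOn (w : ℝ) (m : ℕ) :
    DependsOn (fun x : ℕ → ℝ => waitIter x w m) (Finset.range m : Set ℕ) := by
  intro x y h
  induction m with
  | zero => rfl
  | succ m ih =>
    have ih' : waitIter x w m = waitIter y w m := ih fun i hi => h i (by simp at hi ⊢; omega)
    simp only [waitIter]
    rw [h m (by simp), ih']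

theorem backIter_dependsOn (m : ℕ) :
    DependsOn (backIter m) (Finset.range m : Set ℕ) := by
  induction m with
  | zero => intro x y h; rfl
  | succ m ih =>
    intro x y h
    simp only [backIter]
    rw [h 0 (by simp), @ih (fun i => x (i + 1)) (fun i => y (i + 1))
      fun i hi => h (i + 1) (by simp at hi ⊢; omega)]

@[fun_prop]
theorem measurable_waitIter (w : ℝ) (m : ℕ) : Measurable fun x : ℕ → ℝ => waitIter x w m := by
  induction m with
  | zero => exact measurable_const
  | succ m ih => exact measurable_const.max ((measurable_pi_apply m).sub ih)

@[fun_prop]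
theorem measurable_backIter (m : ℕ) : Measurable (backIter m) := by
  induction m with
  | zero => exact measurable_const
  | succ m ih =>
    refine measurable_const.max ((measurable_pi_apply 0).sub (ih.comp ?_))
    fun_prop

/-- The sequences whose first three terms are at most `a`, at least `2 * a`, at most `a`. Three
steps of the recursion along such a sequence lead from any nonnegative state to `0`. -/
def resetSet (a : ℝ) : Set (ℕ → ℝ) := {x | x 0 ≤ a ∧ 2 * a ≤ x 1 ∧ x 2 ≤ a}

theorem measurableSet_resetSet (a : ℝ) : MeasurableSet (resetSet a) := by
  exact (measurableSet_le (measurable_pi_apply 0) measurable_const).inter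
    ((measurableSet_le measurable_const (measurable_pi_apply 1)).inter
      (measurableSet_le (measurable_pi_apply 2) measurable_const))

theorem reset_eq_zero {a u v t w : ℝ} (ha : 0 ≤ a) (hw : 0 ≤ w) (hu : u ≤ a) (hv : 2 * a ≤ v)
    (ht : t ≤ a) : max 0 (t - max 0 (v - max 0 (u - w))) = 0 := by
  have h1 : max 0 (u - w) ≤ a := max_le ha (by linarith)
  have h2 : a ≤ max 0 (v - max 0 (u - w)) := le_max_of_le_right (by linarith)
  exact max_eq_left (by linarith)

theorem waitIter_eq_of_reset {a : ℝ} (ha : 0 ≤ a) {x : ℕ → ℝ} {j : ℕ}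
    (hx : (fun i => x (i + j)) ∈ resetSet a) {w w' : ℝ} (hw : 0 ≤ w) (hw' : 0 ≤ w') (m : ℕ) :
    waitIter x w (j + 3 + m) = waitIter x w' (j + 3 + m) := by
  have key : ∀ w : ℝ, 0 ≤ w → waitIter x w (j + 3) = 0 := by
    intro w hw
    rw [waitIter_add]
    exact reset_eq_zero ha (waitIter_nonneg x hw j) hx.1 hx.2.1 hx.2.2
  rw [waitIter_add x w, waitIter_add x w', key w hw, key w' hw']

theorem backIter_eq_of_reset {a : ℝ} (ha : 0 ≤ a) {j : ℕ} {x : ℕ → ℝ}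
    (hx : (fun i => x (i + j)) ∈ resetSet a) (m : ℕ) :
    backIter (j + 3 + m) x = backIter j x := by
  induction j generalizing x with
  | zero =>
    rw [show 0 + 3 + m = m + 3 by ring]
    exact reset_eq_zero ha (backIter_nonneg m _) hx.2.2 hx.2.1 hx.1
  | succ j ih =>
    rw [show j + 1 + 3 + m = (j + 3 + m) + 1 by ring, backIter, backIter, ih]
    simpa [add_assoc, add_comm 1 j] using hx

/-- Cesàro means converge to `c` as soon as they do along each residue class modulo `m`. -/
theorem tendsto_cesaro_of_residues {m : ℕ} (hm : 0 < m) {y : ℕ → ℝ} {c : ℝ}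
    (h : ∀ r < m, Tendsto (fun n : ℕ => (∑ i ∈ Finset.range n, y (r + m * i)) / n) atTop (𝓝 c)) :
    Tendsto (fun k : ℕ => (∑ j ∈ Finset.range k, y j) / k) atTop (𝓝 c) := by
  have hm' : (0 : ℝ) < m := by exact_mod_cast hm
  -- the number of `j < k` congruent to `r` modulo `m` is `(k + (m - 1 - r)) / m`
  let N : ℕ → ℕ → ℕ := fun r k => (k + (m - 1 - r)) / m
  have hsum : ∀ k, ∑ j ∈ Finset.range k, y j =
      ∑ r ∈ Finset.range m, ∑ i ∈ Finset.range (N r k), y (r + m * i) := by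
    intro k
    induction k with
    | zero =>
      symm
      refine Finset.sum_eq_zero fun r hr => ?_
      have : N r 0 = 0 := Nat.div_eq_of_lt (by have := Finset.mem_range.1 hr; omega)
      simp [this]
    | succ k ih =>
      have hstep : ∀ r ∈ Finset.range m, ∑ i ∈ Finset.range (N r (k + 1)), y (r + m * i) =
          ∑ i ∈ Finset.range (N r k), y (r + m * i) + if r = k % m then y k else 0 := by
        intro r hr
        have hr' := Finset.mem_range.1 hr
        have hk := Nat.div_add_mod k m
        have hs := Nat.mod_lt k hm
        set q := k / m
        set s := k % m
        have e1 : ∀ t, (m * q + t) / m = q + t / m := fun t => Nat.mul_add_div hm q t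
        have e2 : N r k = q + (s + (m - 1 - r)) / m := by
          simp only [N]; rw [← e1]; congr 1; omega
        have e3 : N r (k + 1) = q + (s + 1 + (m - 1 - r)) / m := by
          simp only [N]; rw [← e1]; congr 1; omega
        by_cases hrs : r = s
        · have e4 : N r k = q := by rw [e2, Nat.div_eq_of_lt (by omega), add_zero]
          have e5 : N r (k + 1) = q + 1 := by
            rw [e3, show s + 1 + (m - 1 - r) = m by omega, Nat.div_self hm]
          rw [e4, e5, Finset.sum_range_succ, if_pos hrs, show r + m * q = k by omega]
        · have e6 : N r (k + 1) = N r k := by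
            rw [e2, e3]
            congr 1
            rcases lt_or_gt_of_ne hrs with h | h
            · rw [Nat.div_eq_of_lt_le (k := 1) (by omega) (by omega),
                Nat.div_eq_of_lt_le (k := 1) (by omega) (by omega)]
            · rw [Nat.div_eq_of_lt (by omega), Nat.div_eq_of_lt (by omega)]
          rw [e6, if_neg hrs, add_zero]
      rw [Finset.sum_range_succ, ih, Finset.sum_congr rfl hstep, Finset.sum_add_distrib]
      simp [Nat.mod_lt k hm]
  have hNtop : ∀ r, Tendsto (N r) atTop atTop := fun r =>
    (Nat.tendsto_div_const_atTop hm.ne').comp (tendsto_add_atTop_nat _)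
  have hNk : ∀ r < m, Tendsto (fun k : ℕ => (N r k : ℝ) / k) atTop (𝓝 (1 / m)) := by
    intro r hr
    have hinv : Tendsto (fun k : ℕ => 1 / (k : ℝ)) atTop (𝓝 0) :=
      tendsto_one_div_atTop_nhds_zero_nat
    have hlo : Tendsto (fun k : ℕ => 1 / (m : ℝ) - 1 / (k : ℝ)) atTop (𝓝 (1 / m)) := by
      simpa using hinv.const_sub (1 / (m : ℝ))
    have hhi : Tendsto (fun k : ℕ => 1 / (m : ℝ) + 1 / (k : ℝ)) atTop (𝓝 (1 / m)) := by
      simpa using hinv.const_add (1 / (m : ℝ))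
    refine tendsto_of_tendsto_of_tendsto_of_le_of_le' hlo hhi ?_ ?_ <;>
      filter_upwards [eventually_gt_atTop 0] with k hk <;>
      have hk' : (0 : ℝ) < k := by exact_mod_cast hk
    · have h1 : k + (m - 1 - r) < m * (N r k + 1) := Nat.lt_mul_div_succ _ hm
      have h2 : (k : ℝ) ≤ m * (N r k + 1) := by exact_mod_cast (by omega : k ≤ m * (N r k + 1))
      rw [div_sub_div _ _ hm'.ne' hk'.ne', div_le_div_iff₀ (by positivity) hk']
      nlinarith
    · have h1 : m * N r k ≤ k + (m - 1 - r) := Nat.mul_div_le _ _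
      have h2 : (m : ℝ) * N r k ≤ k + m := by
        exact_mod_cast (by omega : m * N r k ≤ k + m)
      rw [div_add_div _ _ hm'.ne' hk'.ne', div_le_div_iff₀ hk' (by positivity)]
      nlinarith
  have hres : ∀ r ∈ Finset.range m, Tendsto
      (fun k : ℕ => (∑ i ∈ Finset.range (N r k), y (r + m * i)) / k) atTop (𝓝 (c * (1 / m))) := by
    intro r hr
    have hr' := Finset.mem_range.1 hr
    refine (((h r hr').comp (hNtop r)).mul (hNk r hr')).congr' ?_
    filter_upwards [(hNtop r).eventually_gt_atTop 0] with k hk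
    have : (N r k : ℝ) ≠ 0 := by exact_mod_cast hk.ne'
    simp only [Function.comp]
    field_simp
  have := tendsto_finsetSum _ hres
  simp only [Finset.sum_const, Finset.card_range, nsmul_eq_mul] at this
  rw [show (m : ℝ) * (c * (1 / m)) = c by field_simp] at this
  refine this.congr fun k => ?_
  rw [hsum, Finset.sum_div]

/-! ### The recursion driven by i.i.d. variables -/

/-- The law of a sequence of independent random variables with common law `ξ`. -/
noncomputable abbrev iidLaw (ξ : Measure ℝ) [IsProbabilityMeasure ξ] : Measure (ℕ → ℝ) :=
  Measure.infinitePi fun _ : ℕ => ξ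

section
variable (ξ : Measure ℝ) [IsProbabilityMeasure ξ]

theorem measurePreserving_reindex {f : ℕ → ℕ} (hf : Function.Injective f) :
    MeasurePreserving (fun (x : ℕ → ℝ) i => x (f i)) (iidLaw ξ) (iidLaw ξ) :=
  ⟨by fun_prop, Measure.map_infinitePi_infinitePi_of_inj hf⟩

theorem measurePreserving_shift (j : ℕ) :
    MeasurePreserving (fun (x : ℕ → ℝ) i => x (i + j)) (iidLaw ξ) (iidLaw ξ) :=
  measurePreserving_reindex ξ (add_left_injective j)

theorem measurePreserving_coord (i : ℕ) :
    MeasurePreserving (fun x : ℕ → ℝ => x i) (iidLaw ξ) ξ :=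
  ⟨measurable_pi_apply i, Measure.infinitePi_map_eval _ i⟩

theorem iIndepFun_coord : iIndepFun (fun (i : ℕ) (x : ℕ → ℝ) => x i) (iidLaw ξ) :=
  iIndepFun_infinitePi (P := fun _ : ℕ => ξ) (X := fun _ u => u) fun _ => measurable_id

/-- Functions of disjoint finite sets of coordinates are independent. -/
theorem indepFun_of_dependsOn {f g : (ℕ → ℝ) → ℝ} (hf : Measurable f) (hg : Measurable g)
    {S T : Finset ℕ} (hST : Disjoint S T) (hfS : DependsOn f (S : Set ℕ))
    (hgT : DependsOn g (T : Set ℕ)) : IndepFun f g (iidLaw ξ) := by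
  have hext : ∀ U : Finset ℕ, Measurable fun (v : U → ℝ) (i : ℕ) =>
      if h : i ∈ U then v ⟨i, h⟩ else 0 := by
    intro U
    refine measurable_pi_lambda _ fun i => ?_
    by_cases h : i ∈ U
    · simpa [h] using measurable_pi_apply _
    · simp [h]
  have key := ((iIndepFun_coord ξ).indepFun_finset S T hST fun i => measurable_pi_apply i).comp
    (hf.comp (hext S)) (hg.comp (hext T))
  convert key using 1
  · ext x
    refine hfS fun i hi => ?_
    have : i ∈ S := hi
    simp [this]
  · ext x
    refine hgT fun i hi => ?_
    have : i ∈ T := hi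
    simp [this]

/-- Strong law of large numbers for the windows of length `m` of an i.i.d. sequence: the windows
starting at the points of one residue class modulo `m` are independent. -/
theorem strong_law_windows {m : ℕ} (hm : 0 < m) {g : (ℕ → ℝ) → ℝ} (hg : Measurable g)
    (hgm : DependsOn g (Finset.range m : Set ℕ)) (hint : Integrable g (iidLaw ξ)) :
    ∀ᵐ x ∂iidLaw ξ, Tendsto
      (fun k : ℕ => (∑ j ∈ Finset.range k, g fun i => x (i + j)) / k) atTop
      (𝓝 (∫ x, g x ∂iidLaw ξ)) := by
  have hmp := measurePreserving_shift ξ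
  have hgj : ∀ j, Measurable fun x : ℕ → ℝ => g fun i => x (i + j) := fun j =>
    hg.comp (hmp j).measurable
  have hid : ∀ j j', IdentDistrib (fun x : ℕ → ℝ => g fun i => x (i + j))
      (fun x : ℕ → ℝ => g fun i => x (i + j')) (iidLaw ξ) (iidLaw ξ) := by
    intro j j'
    refine ⟨(hgj j).aemeasurable, (hgj j').aemeasurable, ?_⟩
    rw [show (fun x : ℕ → ℝ => g fun i => x (i + j)) = g ∘ (fun x i => x (i + j)) from rfl,
      show (fun x : ℕ → ℝ => g fun i => x (i + j')) = g ∘ (fun x i => x (i + j')) from rfl,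
      ← Measure.map_map hg (hmp j).measurable, ← Measure.map_map hg (hmp j').measurable,
      (hmp j).map_eq, (hmp j').map_eq]
  have hdep : ∀ j, DependsOn (fun x : ℕ → ℝ => g fun i => x (i + j))
      (Finset.Ico j (j + m) : Set ℕ) := by
    intro j x y h
    exact hgm fun i hi => h (i + j) (by simp at hi ⊢; omega)
  have hres : ∀ r : ℕ, ∀ᵐ x ∂iidLaw ξ, Tendsto
      (fun n : ℕ => (∑ i ∈ Finset.range n, g fun l => x (l + (r + m * i))) / n) atTop
      (𝓝 (∫ x, g x ∂iidLaw ξ)) := by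
    intro r
    have := strong_law_ae_real (μ := iidLaw ξ) (fun i (x : ℕ → ℝ) => g fun l => x (l + (r + m * i)))
      ((hmp _).integrable_comp_of_integrable hint) ?_ fun i => hid _ _
    · have hE : ∫ x, g (fun l => x (l + (r + m * 0))) ∂iidLaw ξ = ∫ x, g x ∂iidLaw ξ := by
        rw [← (hmp (r + m * 0)).map_eq, integral_map (hmp _).measurable.aemeasurable
          hg.aestronglyMeasurable, (hmp _).map_eq]
      rwa [hE] at this
    · intro i i' hii
      refine indepFun_of_dependsOn ξ (hgj _) (hgj _) ?_ (hdep _) (hdep _)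
      rw [Finset.disjoint_left]
      intro l hl hl'
      rw [Finset.mem_Ico] at hl hl'
      rcases lt_or_gt_of_ne hii with h | h
      · have : m * (i + 1) ≤ m * i' := Nat.mul_le_mul_left m h
        rw [mul_add] at this
        omega
      · have : m * (i' + 1) ≤ m * i := Nat.mul_le_mul_left m h
        rw [mul_add] at this
        omega
  filter_upwards [ae_all_iff.2 hres] with x hx
  exact tendsto_cesaro_of_residues hm fun r _ => hx r

theorem resetSet_pos {a : ℝ} (h1 : 0 < ξ (Set.Iic a)) (h2 : 0 < ξ (Set.Ici (2 * a))) :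
    0 < iidLaw ξ (resetSet a) := by
  let t : ℕ → Set ℝ := fun i => if i = 1 then Set.Ici (2 * a) else Set.Iic a
  have : resetSet a = Set.pi (Finset.range 3 : Set ℕ) t := by
    ext x
    simp only [resetSet, Set.mem_ofPred_eq, Set.mem_pi, Finset.mem_coe, Finset.mem_range]
    constructor
    · rintro ⟨h0, h1, h2⟩ i hi
      interval_cases i <;> simpa [t]
    · intro h
      exact ⟨by simpa [t] using h 0, by simpa [t] using h 1, by simpa [t] using h 2⟩
  rw [this, Measure.infinitePi_pi _ fun i _ => by simp only [t]; split_ifs <;> measurability]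
  simpa [Finset.prod_range_succ, t] using ⟨⟨h1, h2⟩, h1⟩

/-- Almost surely a reset occurs. -/
theorem ae_exists_reset {a : ℝ} (h1 : 0 < ξ (Set.Iic a)) (h2 : 0 < ξ (Set.Ici (2 * a))) :
    ∀ᵐ x ∂iidLaw ξ, ∃ j : ℕ, (fun i => x (i + j)) ∈ resetSet a := by
  have hmeas := measurableSet_resetSet a
  have hdep : DependsOn ((resetSet a).indicator fun _ => (1 : ℝ)) (Finset.range 3 : Set ℕ) := by
    intro x y h
    have h0 := h 0 (by simp)
    have h1 := h 1 (by simp)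
    have h2 := h 2 (by simp)
    have hxy : x ∈ resetSet a ↔ y ∈ resetSet a := by
      simp only [resetSet, Set.mem_ofPred_eq, h0, h1, h2]
    by_cases hx : x ∈ resetSet a
    · rw [Set.indicator_of_mem hx, Set.indicator_of_mem (hxy.1 hx)]
    · rw [Set.indicator_of_notMem hx, Set.indicator_of_notMem fun hy => hx (hxy.2 hy)]
  have hint : Integrable ((resetSet a).indicator fun _ => (1 : ℝ)) (iidLaw ξ) :=
    (integrable_const 1).indicator hmeas
  filter_upwards [strong_law_windows ξ (by norm_num) (measurable_const.indicator hmeas) hdep hint]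
    with x hx
  by_contra! hno
  have hz : (fun k : ℕ => (∑ j ∈ Finset.range k,
      (resetSet a).indicator (fun _ => (1 : ℝ)) fun i => x (i + j)) / k) = fun _ => 0 := by
    ext k
    rw [Finset.sum_eq_zero fun j _ => Set.indicator_of_notMem (hno j) _, zero_div]
  rw [hz, integral_indicator_const _ hmeas] at hx
  have := tendsto_nhds_unique hx tendsto_const_nhds
  simp [measureReal_def, ENNReal.toReal_eq_zero_iff, (resetSet_pos ξ h1 h2).ne'] at this

/-- The recursion forgets its initial value. -/
theorem ae_waitIter_eventually_eq {a : ℝ} (ha : 0 ≤ a) (h1 : 0 < ξ (Set.Iic a))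
    (h2 : 0 < ξ (Set.Ici (2 * a))) :
    ∀ᵐ x ∂iidLaw ξ, ∀ w : ℝ, 0 ≤ w → ∀ᶠ k in atTop, waitIter x w k = waitIter x 0 k := by
  filter_upwards [ae_exists_reset ξ h1 h2] with x ⟨j, hj⟩ w hw
  filter_upwards [eventually_ge_atTop (j + 3)] with k hk
  obtain ⟨m, rfl⟩ := Nat.exists_eq_add_of_le hk
  exact waitIter_eq_of_reset ha hj hw le_rfl m

/-- The first coordinate is independent of the backward iterate of the remaining ones. -/
theorem map_coord_backIter_shift (m : ℕ) :
    (iidLaw ξ).map (fun x : ℕ → ℝ => (x 0, backIter m fun i => x (i + 1))) =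
      ξ.prod ((iidLaw ξ).map (backIter m)) := by
  have hsh := measurePreserving_shift ξ 1
  have hback : Measurable fun x : ℕ → ℝ => backIter m fun i => x (i + 1) :=
    (measurable_backIter m).comp hsh.measurable
  have hco : Measurable fun x : ℕ → ℝ => x 0 := measurable_pi_apply 0
  rw [(indepFun_iff_map_prod_eq_prod_map_map hco.aemeasurable hback.aemeasurable).1
    (indepFun_of_dependsOn ξ (S := {0}) (T := Finset.Ico 1 (m + 1)) hco hback (by simp)
      (fun x y h => h 0 (by simp)) ?_), (measurePreserving_coord ξ 0).map_eq]
  · congr 1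
    conv_rhs => rw [← hsh.map_eq, Measure.map_map (measurable_backIter m) hsh.measurable]
    rfl
  · intro x y h
    exact backIter_dependsOn m fun i hi => h (i + 1) (by simp at hi ⊢; omega)

/-- Reversing the order of finitely many i.i.d. variables does not change their joint law; here
this is seen from the recursion `ρ ↦ law of max 0 (x - u)` under `ξ ⊗ ρ` that both sides satisfy. -/
theorem map_waitIter_eq_map_backIter (m : ℕ) :
    (iidLaw ξ).map (fun x => waitIter x 0 m) = (iidLaw ξ).map (backIter m) := by
  induction m with
  | zero => rfl
  | succ m ih =>
    have hmax : Measurable fun p : ℝ × ℝ => max 0 (p.1 - p.2) := by fun_prop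
    have hsh := measurePreserving_shift ξ 1
    have hback : Measurable fun x : ℕ → ℝ => backIter m fun i => x (i + 1) :=
      (measurable_backIter m).comp hsh.measurable
    have hco : ∀ i, Measurable fun x : ℕ → ℝ => x i := measurable_pi_apply
    have hdepc : ∀ i : ℕ, DependsOn (fun x : ℕ → ℝ => x i) (({i} : Finset ℕ) : Set ℕ) :=
      fun i x y h => h i (by simp)
    have e1 : (iidLaw ξ).map (fun x : ℕ → ℝ => (x m, waitIter x 0 m)) =
        ξ.prod ((iidLaw ξ).map fun x => waitIter x 0 m) := by
      rw [(indepFun_iff_map_prod_eq_prod_map_map (hco m).aemeasurable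
        (measurable_waitIter 0 m).aemeasurable).1 (indepFun_of_dependsOn ξ (hco m)
          (measurable_waitIter 0 m) (by simp) (hdepc m) (waitIter_dependsOn 0 m)),
        (measurePreserving_coord ξ m).map_eq]
    calc (iidLaw ξ).map (fun x => waitIter x 0 (m + 1))
        = ((iidLaw ξ).map fun x : ℕ → ℝ => (x m, waitIter x 0 m)).map
            fun p => max 0 (p.1 - p.2) := by
          rw [Measure.map_map hmax ((hco m).prodMk (measurable_waitIter 0 m))]; rfl
      _ = ((iidLaw ξ).map fun x : ℕ → ℝ => (x 0, backIter m fun i => x (i + 1))).map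
            fun p => max 0 (p.1 - p.2) := by rw [e1, map_coord_backIter_shift, ih]
      _ = (iidLaw ξ).map (backIter (m + 1)) := by
          rw [Measure.map_map hmax ((hco 0).prodMk hback)]; rfl

end

/-! ### The limiting law and the law of large numbers -/

section
variable (ξ : Measure ℝ) [IsProbabilityMeasure ξ]

/-- Almost surely the backward iterates are eventually constant, hence convergent. -/
theorem exists_backIter_limit {a : ℝ} (ha : 0 ≤ a) (h1 : 0 < ξ (Set.Iic a))
    (h2 : 0 < ξ (Set.Ici (2 * a))) :
    ∃ V : (ℕ → ℝ) → ℝ, Measurable V ∧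
      ∀ᵐ x ∂iidLaw ξ, Tendsto (fun m => backIter m x) atTop (𝓝 (V x)) := by
  refine measurable_limit_of_tendsto_metrizable_ae
    (fun m => (measurable_backIter m).aemeasurable) ?_
  filter_upwards [ae_exists_reset ξ h1 h2] with x ⟨j, hj⟩
  refine ⟨backIter j x, tendsto_const_nhds.congr' ?_⟩
  filter_upwards [eventually_ge_atTop (j + 3)] with k hk
  obtain ⟨m, rfl⟩ := Nat.exists_eq_add_of_le hk
  exact (backIter_eq_of_reset ha hj m).symm

variable {ξ}
variable {V : (ℕ → ℝ) → ℝ}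

theorem ae_backIter_limit_nonneg
    (hV : ∀ᵐ x ∂iidLaw ξ, Tendsto (fun m => backIter m x) atTop (𝓝 (V x))) :
    ∀ᵐ x ∂iidLaw ξ, 0 ≤ V x := by
  filter_upwards [hV] with x hx
  exact ge_of_tendsto' hx fun m => backIter_nonneg m x

theorem integrable_abs_coord (hξ : Integrable (fun x : ℝ => x) ξ) :
    Integrable (fun x : ℕ → ℝ => |x 0|) (iidLaw ξ) :=
  ((measurePreserving_coord ξ 0).integrable_comp_of_integrable hξ).abs

theorem integrable_backIter (hξ : Integrable (fun x : ℝ => x) ξ) (m : ℕ) :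
    Integrable (backIter m) (iidLaw ξ) :=
  (integrable_abs_coord hξ).mono' (measurable_backIter m).aestronglyMeasurable
    (ae_of_all _ fun x => by
      rw [Real.norm_of_nonneg (backIter_nonneg m x)]; exact backIter_le_abs m x)

theorem integrable_backIter_limit (hξ : Integrable (fun x : ℝ => x) ξ) (hVm : Measurable V)
    (hV : ∀ᵐ x ∂iidLaw ξ, Tendsto (fun m => backIter m x) atTop (𝓝 (V x))) :
    Integrable V (iidLaw ξ) := by
  refine (integrable_abs_coord hξ).mono' hVm.aestronglyMeasurable ?_
  filter_upwards [hV, ae_backIter_limit_nonneg hV] with x hx h0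
  rw [Real.norm_of_nonneg h0]
  exact le_of_tendsto' hx fun m => backIter_le_abs m x

theorem tendsto_integral_backIter (hξ : Integrable (fun x : ℝ => x) ξ)
    (hV : ∀ᵐ x ∂iidLaw ξ, Tendsto (fun m => backIter m x) atTop (𝓝 (V x))) :
    Tendsto (fun m => ∫ x, backIter m x ∂iidLaw ξ) atTop (𝓝 (∫ x, V x ∂iidLaw ξ)) := by
  refine tendsto_integral_of_dominated_convergence (fun x => |x 0|)
    (fun m => (measurable_backIter m).aestronglyMeasurable) (integrable_abs_coord hξ)
    (fun m => ae_of_all _ fun x => ?_) hV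
  rw [Real.norm_of_nonneg (backIter_nonneg m x)]
  exact backIter_le_abs m x

theorem integrable_max_sub (hξ : Integrable (fun x : ℝ => x) ξ) (w : ℝ) :
    Integrable (fun x : ℝ => max 0 (x - w)) ξ :=
  (integrable_const 0).sup (hξ.sub (integrable_const w))

theorem continuous_integral_max_sub (hξ : Integrable (fun x : ℝ => x) ξ) :
    Continuous fun w : ℝ => ∫ x, max 0 (x - w) ∂ξ := by
  refine (LipschitzWith.of_dist_le_mul (K := 1) fun w w' => ?_).continuous
  rw [Real.dist_eq, ← integral_sub (integrable_max_sub hξ w) (integrable_max_sub hξ w')]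
  calc |∫ x, (max 0 (x - w) - max 0 (x - w')) ∂ξ|
      ≤ ∫ _, |w - w'| ∂ξ := by
        refine norm_integral_le_of_norm_le (G := ℝ) (μ := ξ) (g := fun _ => |w - w'|)
          (integrable_const _) (ae_of_all _ fun x => ?_)
        refine (abs_max_sub_max_le_max _ _ _ _).trans ?_
        simp [abs_sub_comm]
    _ = (1 : NNReal) * dist w w' := by simp [Real.dist_eq]

/-- The mean of the limit satisfies the stationarity equation: `V` has the same mean as
`max 0 (X - V)`, where `X` has law `ξ` and is independent of `V`. -/
theorem integral_backIter_limit_eq (hξ : Integrable (fun x : ℝ => x) ξ)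
    (hV : ∀ᵐ x ∂iidLaw ξ, Tendsto (fun m => backIter m x) atTop (𝓝 (V x))) :
    ∫ x, V x ∂iidLaw ξ = ∫ x, (∫ y, max 0 (y - V x) ∂ξ) ∂iidLaw ξ := by
  set H : ℝ → ℝ := fun w => ∫ y, max 0 (y - w) ∂ξ with hH
  have hHc : Continuous H := continuous_integral_max_sub hξ
  have hstep : ∀ m, ∫ x, backIter (m + 1) x ∂iidLaw ξ = ∫ x, H (backIter m x) ∂iidLaw ξ := by
    intro m
    have hmax : Measurable fun p : ℝ × ℝ => max 0 (p.1 - p.2) := by fun_prop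
    have hpair : Measurable fun x : ℕ → ℝ => (x 0, backIter m fun i => x (i + 1)) :=
      (measurable_pi_apply 0).prodMk
        ((measurable_backIter m).comp (measurePreserving_shift ξ 1).measurable)
    have hmap := map_coord_backIter_shift ξ m
    have hint : Integrable (fun p : ℝ × ℝ => max 0 (p.1 - p.2))
        (ξ.prod ((iidLaw ξ).map (backIter m))) := by
      rw [← hmap, integrable_map_measure hmax.aestronglyMeasurable hpair.aemeasurable]
      exact integrable_backIter hξ (m + 1)
    have : IsProbabilityMeasure ((iidLaw ξ).map (backIter m)) :=
      Measure.isProbabilityMeasure_map (measurable_backIter m).aemeasurable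
    calc ∫ x, backIter (m + 1) x ∂iidLaw ξ
        = ∫ p : ℝ × ℝ, max 0 (p.1 - p.2) ∂ξ.prod ((iidLaw ξ).map (backIter m)) := by
          rw [← hmap, integral_map hpair.aemeasurable hmax.aestronglyMeasurable]; rfl
      _ = ∫ w, H w ∂(iidLaw ξ).map (backIter m) := integral_prod_symm _ hint
      _ = ∫ x, H (backIter m x) ∂iidLaw ξ :=
          integral_map (measurable_backIter m).aemeasurable hHc.aestronglyMeasurable
  have hlim := (tendsto_add_atTop_iff_nat 1).2 (tendsto_integral_backIter hξ hV)
  refine tendsto_nhds_unique hlim ?_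
  simp_rw [hstep]
  refine tendsto_integral_of_dominated_convergence (fun _ => ∫ y, |y| ∂ξ)
    (fun m => (hHc.measurable.comp (measurable_backIter m)).aestronglyMeasurable)
    (integrable_const _) (fun m => ae_of_all _ fun x => ?_) ?_
  · refine norm_integral_le_of_norm_le hξ.abs (ae_of_all _ fun y => ?_)
    rw [Real.norm_of_nonneg (le_max_left _ _)]
    exact max_le (abs_nonneg y) (by linarith [le_abs_self y, backIter_nonneg m x])
  · filter_upwards [hV] with x hx
    exact (hHc.tendsto _).comp hx

/-- The state at time `j + m` lies above, for even `m`, and below, for odd `m`, the state reached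
in `m` steps from `0` at time `j`. Hence the Cesàro means of the recursion are squeezed between
those of its windows. -/
theorem tendsto_cesaro_waitIter {x : ℕ → ℝ} {w : ℝ} (hw : 0 ≤ w) {c : ℕ → ℝ} {L : ℝ}
    (hc : Tendsto c atTop (𝓝 L))
    (h : ∀ m, Tendsto (fun k : ℕ => (∑ j ∈ Finset.range k, waitIter (fun i => x (i + j)) 0 m) / k)
      atTop (𝓝 (c m))) :
    Tendsto (fun k : ℕ => (∑ j ∈ Finset.range k, waitIter x w j) / k) atTop (𝓝 L) := by
  have hsplit : ∀ m k, ∑ j ∈ Finset.range (k + m), waitIter x w j =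
      ∑ j ∈ Finset.range m, waitIter x w j +
        ∑ j ∈ Finset.range k, waitIter (fun i => x (i + j)) (waitIter x w j) m := by
    intro m k
    rw [add_comm k m, Finset.sum_range_add]
    congr 1
    exact Finset.sum_congr rfl fun j _ => by rw [add_comm m j, waitIter_add]
  -- the Cesàro means of the windows, with the boundary term and the normalisation of `hsplit`
  have hshift : ∀ m (C : ℝ), Tendsto (fun k : ℕ =>
      (C + ∑ j ∈ Finset.range k, waitIter (fun i => x (i + j)) 0 m) / ((k + m : ℕ) : ℝ)) atTop
      (𝓝 (c m)) := by
    intro m C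
    have hkm : Tendsto (fun k : ℕ => ((k + m : ℕ) : ℝ)) atTop atTop :=
      tendsto_natCast_atTop_atTop.comp (tendsto_add_atTop_nat m)
    have h1 : Tendsto (fun k : ℕ => C / ((k + m : ℕ) : ℝ)) atTop (𝓝 0) :=
      tendsto_const_nhds.div_atTop hkm
    have h2 : Tendsto (fun k : ℕ => (k : ℝ) / ((k + m : ℕ) : ℝ)) atTop (𝓝 1) := by
      have := (tendsto_const_nhds (x := (m : ℝ))).div_atTop hkm
      refine (this.const_sub 1).congr' ?_ |>.trans (by simp)
      filter_upwards [eventually_gt_atTop 0] with k hk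
      have : ((k + m : ℕ) : ℝ) ≠ 0 := by positivity
      rw [eq_div_iff this, sub_mul, div_mul_cancel₀ _ this]
      push_cast
      ring
    have h3 := h1.add ((h m).mul h2)
    rw [zero_add, mul_one] at h3
    refine h3.congr' ?_
    filter_upwards [eventually_gt_atTop 0] with k hk
    have hk' : (k : ℝ) ≠ 0 := by exact_mod_cast hk.ne'
    have : ((k + m : ℕ) : ℝ) ≠ 0 := by positivity
    rw [add_div, div_mul_div_cancel₀ hk']
  have hW := waitIter_nonneg x hw
  refine tendsto_order.2 ⟨fun l hl => ?_, fun u hu => ?_⟩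
  · obtain ⟨m₀, hm₀⟩ := eventually_atTop.1 (hc.eventually (lt_mem_nhds hl))
    have hm := hm₀ (2 * m₀) (by omega)
    set m := 2 * m₀ with hm_def
    rw [← map_add_atTop_eq_nat m, eventually_map]
    filter_upwards [(hshift m 0).eventually (lt_mem_nhds hm)] with k hk
    refine hk.trans_le (div_le_div_of_nonneg_right ?_ (Nat.cast_nonneg _))
    rw [hsplit]
    refine add_le_add (Finset.sum_nonneg fun j _ => hW j) (Finset.sum_le_sum fun j _ => ?_)
    exact (waitIter_parity _ (hW j) m).1 ⟨m₀, by omega⟩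
  · obtain ⟨m₀, hm₀⟩ := eventually_atTop.1 (hc.eventually (gt_mem_nhds hu))
    have hm := hm₀ (2 * m₀ + 1) (by omega)
    set m := 2 * m₀ + 1 with hm_def
    rw [← map_add_atTop_eq_nat m, eventually_map]
    filter_upwards [(hshift m (∑ j ∈ Finset.range m, waitIter x w j)).eventually (gt_mem_nhds hm)]
      with k hk
    refine lt_of_le_of_lt (div_le_div_of_nonneg_right ?_ (Nat.cast_nonneg _)) hk
    rw [hsplit]
    gcongr with j _
    exact (waitIter_parity _ (hW j) m).2 ⟨m₀, by omega⟩

/-- Strong law of large numbers for the recursion, from every initial value simultaneously. -/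
theorem ae_tendsto_cesaro_waitIter (hξ : Integrable (fun x : ℝ => x) ξ)
    (hV : ∀ᵐ x ∂iidLaw ξ, Tendsto (fun m => backIter m x) atTop (𝓝 (V x))) :
    ∀ᵐ x ∂iidLaw ξ, ∀ w : ℝ, 0 ≤ w →
      Tendsto (fun k : ℕ => (∑ j ∈ Finset.range k, waitIter x w j) / k) atTop
        (𝓝 (∫ x, V x ∂iidLaw ξ)) := by
  have hident : ∀ m, IdentDistrib (fun x => waitIter x 0 m) (backIter m) (iidLaw ξ) (iidLaw ξ) :=
    fun m => ⟨(measurable_waitIter 0 m).aemeasurable, (measurable_backIter m).aemeasurable,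
      map_waitIter_eq_map_backIter ξ m⟩
  have hwin : ∀ m : ℕ, ∀ᵐ x ∂iidLaw ξ, Tendsto (fun k : ℕ =>
      (∑ j ∈ Finset.range k, waitIter (fun i => x (i + j)) 0 m) / k) atTop
      (𝓝 (∫ x, backIter m x ∂iidLaw ξ)) := by
    intro m
    rw [← (hident m).integral_eq]
    -- a window of length `m + 1` is used because `strong_law_windows` asks for positive length
    exact strong_law_windows ξ m.succ_pos (measurable_waitIter 0 m)
      ((waitIter_dependsOn 0 m).mono (by simp))
      ((hident m).integrable_iff.2 (integrable_backIter hξ m))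
  filter_upwards [ae_all_iff.2 hwin] with x hx w hw
  exact tendsto_cesaro_waitIter hw (tendsto_integral_backIter hξ hV) hx

/-- Convergence in distribution of the recursion started from `0`. -/
theorem tendstoInDistribution_waitIter (hVm : Measurable V)
    (hV : ∀ᵐ x ∂iidLaw ξ, Tendsto (fun m => backIter m x) atTop (𝓝 (V x))) :
    TendstoInDistribution (fun m x => waitIter x 0 m) atTop V (fun _ => iidLaw ξ) (iidLaw ξ) := by
  have h := tendstoInDistribution_of_ae_tendsto
    (fun m => (measurable_backIter m).aemeasurable) hVm.aemeasurable hV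
  refine ⟨fun m => (measurable_waitIter 0 m).aemeasurable, hVm.aemeasurable, ?_⟩
  exact h.tendsto.congr fun m => Subtype.ext (map_waitIter_eq_map_backIter ξ m).symm

end

/-! ### Erlang distributions -/

section
variable (r : ℝ) [hr : Fact (0 < r)]

instance isProbabilityMeasure_expMeasure_of_fact : IsProbabilityMeasure (expMeasure r) :=
  isProbabilityMeasure_expMeasure Fact.out

instance isProbabilityMeasure_erlangMeasure (n : ℕ) :
    IsProbabilityMeasure (erlangMeasure n r) :=
  Measure.isProbabilityMeasure_map (by fun_prop)

theorem erlangMeasure_zero : erlangMeasure 0 r = Measure.dirac 0 := by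
  simp [erlangMeasure, Measure.map_const]

theorem erlangMeasure_succ (n : ℕ) :
    erlangMeasure (n + 1) r =
      ((expMeasure r).prod (erlangMeasure n r)).map fun p => p.1 + p.2 := by
  have h := measurePreserving_piFinSuccAbove (fun _ : Fin (n + 1) => expMeasure r) 0
  have hs : Measurable fun x : Fin n → ℝ => ∑ j, x j := by fun_prop
  have e : (fun x : Fin (n + 1) → ℝ => ∑ j, x j) =
      (fun p : ℝ × (Fin n → ℝ) => p.1 + ∑ j, p.2 j) ∘
        MeasurableEquiv.piFinSuccAbove (fun _ => ℝ) 0 := by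
    ext x
    rw [Fin.sum_univ_succ]
    rfl
  have key := Measure.map_prod_map (expMeasure r) (Measure.pi fun _ : Fin n => expMeasure r)
    measurable_id hs
  rw [Measure.map_id] at key
  rw [erlangMeasure, e, ← Measure.map_map (by fun_prop) (by fun_prop), h.map_eq, erlangMeasure,
    key, Measure.map_map (by fun_prop) (by fun_prop)]
  rfl

theorem toReal_exponentialPDF (x : ℝ) :
    (exponentialPDF r x).toReal = if 0 ≤ x then r * Real.exp (-(r * x)) else 0 := by
  rw [exponentialPDF_eq, ENNReal.toReal_ofReal]
  split_ifs
  · exact mul_nonneg hr.out.le (Real.exp_pos _).le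
  · exact le_rfl

theorem integral_expMeasure (f : ℝ → ℝ) :
    ∫ x, f x ∂expMeasure r = ∫ x in Set.Ioi 0, r * Real.exp (-(r * x)) * f x := by
  have h : ∫ x, f x ∂volume.withDensity (exponentialPDF r) =
      ∫ x, (exponentialPDF r x).toReal • f x :=
    integral_withDensity_eq_integral_toReal_smul
      (measurable_exponentialPDFReal r).ennreal_ofReal (ae_of_all _ fun _ => ENNReal.ofReal_lt_top) f
  rw [← integral_Ici_eq_integral_Ioi, ← integral_indicator measurableSet_Ici]
  refine h.trans (integral_congr_ae (ae_of_all _ fun x => ?_))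
  simp only [toReal_exponentialPDF, Set.indicator, Set.mem_Ici, smul_eq_mul]
  split_ifs <;> simp

theorem integrable_expMeasure_iff (f : ℝ → ℝ) :
    Integrable f (expMeasure r) ↔
      IntegrableOn (fun x => r * Real.exp (-(r * x)) * f x) (Set.Ioi 0) := by
  have h : Integrable f (volume.withDensity (exponentialPDF r)) ↔
      Integrable (fun x => f x * (exponentialPDF r x).toReal) :=
    integrable_withDensity_iff
      (measurable_exponentialPDFReal r).ennreal_ofReal (ae_of_all _ fun _ => ENNReal.ofReal_lt_top)
  rw [← integrableOn_Ici_iff_integrableOn_Ioi, ← integrable_indicator_iff measurableSet_Ici]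
  refine h.trans (integrable_congr (ae_of_all _ fun x => ?_))
  simp only [toReal_exponentialPDF, Set.indicator, Set.mem_Ici]
  split_ifs <;> ring

/-- The antiderivative is `-exp (-r x) (c + (x - y) + 1 / r)`; the case `y = c = 0` is the mean of
the exponential law. -/
theorem integral_exp_mul_affine_Ioi {c : ℝ} (hc : 0 ≤ c) (y : ℝ) :
    IntegrableOn (fun x => r * Real.exp (-(r * x)) * (c + (x - y))) (Set.Ioi y) ∧
    ∫ x in Set.Ioi y, r * Real.exp (-(r * x)) * (c + (x - y)) =
      Real.exp (-(r * y)) * (c + 1 / r) := by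
  have hr0 : r ≠ 0 := hr.out.ne'
  let F : ℝ → ℝ := fun x => -(Real.exp (-(r * x)) * (c + (x - y) + 1 / r))
  have hF : ∀ x, HasDerivAt F (r * Real.exp (-(r * x)) * (c + (x - y))) x := by
    intro x
    have h1 : HasDerivAt (fun x : ℝ => Real.exp (-(r * x))) (Real.exp (-(r * x)) * -(r * 1)) x :=
      ((hasDerivAt_id x).const_mul r).neg.exp
    have h2 : HasDerivAt (fun x : ℝ => c + (x - y) + 1 / r) 1 x :=
      (((hasDerivAt_id x).sub_const y).const_add c).add_const _
    refine (h1.mul h2).neg.congr_deriv ?_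
    field_simp
    ring
  have hlim : Tendsto F atTop (𝓝 0) := by
    have hx : Tendsto (fun x : ℝ => r * x) atTop atTop := tendsto_id.const_mul_atTop hr.out
    have h0 := (Real.tendsto_pow_mul_exp_neg_atTop_nhds_zero 0).comp hx
    have h1 := (Real.tendsto_pow_mul_exp_neg_atTop_nhds_zero 1).comp hx
    have := ((h0.mul_const (c - y + 1 / r)).add (h1.mul_const (1 / r))).neg
    simp only [zero_mul, add_zero, neg_zero] at this
    refine this.congr fun x => ?_
    simp only [F, Function.comp]
    field_simp
    ring
  have hint := integrableOn_Ioi_deriv_of_nonneg (hF y).continuousAt.continuousWithinAt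
    (fun x _ => hF x) (fun x hx => mul_nonneg (mul_nonneg hr.out.le (Real.exp_pos _).le)
      (by have : y < x := hx; linarith)) hlim
  refine ⟨hint, ?_⟩
  rw [integral_Ioi_of_hasDerivAt_of_tendsto (hF y).continuousAt.continuousWithinAt
    (fun x _ => hF x) hint hlim]
  simp [F]

theorem integrable_erlangMeasure (n : ℕ) : Integrable (fun x : ℝ => x) (erlangMeasure n r) := by
  induction n with
  | zero => rw [erlangMeasure_zero]; exact integrable_dirac (by simp)
  | succ n ih =>
    have hexp : Integrable (fun x : ℝ => x) (expMeasure r) := by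
      rw [integrable_expMeasure_iff]
      simpa using (integral_exp_mul_affine_Ioi r le_rfl 0).1
    rw [erlangMeasure_succ, integrable_map_measure (by fun_prop) (by fun_prop)]
    exact (hexp.comp_fst _).add (ih.comp_snd _)

/-- The mean excess over `y` of an Erlang variable. For `y ≥ 0` the formula says that, of the `n`
exponential phases, exactly `i` are completed by time `y` with the Poisson probability
`exp (-r y) (r y) ^ i / i!`, and each of the remaining phases has mean `1 / r`. -/
theorem integral_max_sub_erlangMeasure (n : ℕ) (y : ℝ) :
    ∫ b, max 0 (b - y) ∂erlangMeasure n r =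
      if y < 0 then n / r - y else
        Real.exp (-(r * y)) *
          ∑ i ∈ Finset.range n, (r * y) ^ i / (i.factorial : ℝ) * ((n - i) / r) := by
  have hr0 : r ≠ 0 := hr.out.ne'
  induction n generalizing y with
  | zero =>
    rw [erlangMeasure_zero, integral_dirac]
    split_ifs with h
    · simp [h.le]
    · simpa using h
  | succ n ih =>
    have hmax : Measurable fun b : ℝ => max 0 (b - y) := by fun_prop
    have hadd : Measurable fun p : ℝ × ℝ => p.1 + p.2 := by fun_prop
    have hint : Integrable (fun b : ℝ => max 0 (b - y)) (erlangMeasure (n + 1) r) :=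
      (integrable_const 0).sup ((integrable_erlangMeasure r (n + 1)).sub (integrable_const y))
    rw [erlangMeasure_succ, integrable_map_measure hmax.aestronglyMeasurable hadd.aemeasurable]
      at hint
    replace hint : Integrable (fun p : ℝ × ℝ => max 0 (p.1 + p.2 - y))
        ((expMeasure r).prod (erlangMeasure n r)) := hint
    rw [erlangMeasure_succ, integral_map hadd.aemeasurable hmax.aestronglyMeasurable,
      integral_prod _ hint]
    have hin : ∀ x : ℝ, ∫ b, max 0 (x + b - y) ∂erlangMeasure n r =
        if y - x < 0 then n / r - (y - x) else
        Real.exp (-(r * (y - x))) *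
          ∑ i ∈ Finset.range n, (r * (y - x)) ^ i / (i.factorial : ℝ) * ((n - i) / r) := by
      intro x
      rw [← ih]
      congr with b
      congr 1
      ring
    simp only [hin]
    rw [integral_expMeasure]
    have hn : (0 : ℝ) ≤ n / r := div_nonneg n.cast_nonneg hr.out.le
    split_ifs with hy
    · have h := (integral_exp_mul_affine_Ioi r (by linarith : (0 : ℝ) ≤ n / r - y) 0).2
      simp only [sub_zero, mul_zero, neg_zero, Real.exp_zero, one_mul] at h
      calc _ = ∫ x in Set.Ioi (0 : ℝ), r * Real.exp (-(r * x)) * (n / r - y + x) := by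
            refine setIntegral_congr_fun measurableSet_Ioi fun x hx => ?_
            have : (0 : ℝ) < x := hx
            rw [if_pos (by linarith)]
            ring
        _ = _ := by rw [h]; push_cast; ring
    · push Not at hy
      -- before time `y` the first phase is completed and the recursion hypothesis applies to the
      -- remaining time; after time `y` all the `n` other phases are still to come
      have htail := integral_exp_mul_affine_Ioi r hn y
      set f : ℝ → ℝ := fun x => r * Real.exp (-(r * x)) *
        if y - x < 0 then n / r - (y - x) else
        Real.exp (-(r * (y - x))) *
          ∑ i ∈ Finset.range n, (r * (y - x)) ^ i / (i.factorial : ℝ) * ((n - i) / r) with hf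
      let g : ℝ → ℝ := fun x => Real.exp (-(r * y)) *
        ∑ i ∈ Finset.range n, (y - x) ^ i * (r ^ i / (i.factorial : ℝ) * (n - i))
      have hfg : Set.EqOn f g (Set.Ioc 0 y) := by
        intro x hx
        have : ¬ y - x < 0 := by linarith [hx.2]
        simp only [hf, g, if_neg this]
        rw [show -(r * y) = -(r * x) + -(r * (y - x)) by ring, Real.exp_add, Finset.mul_sum,
          Finset.mul_sum, Finset.mul_sum]
        refine Finset.sum_congr rfl fun i _ => ?_
        rw [mul_pow]
        field_simp
      have hft : Set.EqOn f (fun x => r * Real.exp (-(r * x)) * (n / r + (x - y))) (Set.Ioi y) := by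
        intro x hx
        have : y < x := hx
        simp only [hf]
        rw [if_pos (by linarith)]
        ring
      have hgc : Continuous g := by fun_prop
      rw [← Set.Ioc_union_Ioi_eq_Ioi hy, setIntegral_union (Set.Ioc_disjoint_Ioi le_rfl)
        measurableSet_Ioi
        ((hgc.integrableOn_Ioc).congr_fun hfg.symm measurableSet_Ioc)
        (htail.1.congr_fun hft.symm measurableSet_Ioi),
        setIntegral_congr_fun measurableSet_Ioc hfg, setIntegral_congr_fun measurableSet_Ioi hft,
        htail.2, ← intervalIntegral.integral_of_le hy]
      have hpow : ∀ i : ℕ, ∫ x in (0 : ℝ)..y, (y - x) ^ i = y ^ (i + 1) / (i + 1) := by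
        intro i
        rw [intervalIntegral.integral_comp_sub_left (fun x => x ^ i) y]
        simp
      simp only [g]
      rw [intervalIntegral.integral_const_mul, intervalIntegral.integral_finsetSum
        fun i _ => (by fun_prop : Continuous _).intervalIntegrable _ _, ← mul_add,
        Finset.sum_range_succ']
      congr 1
      congr 1
      · refine Finset.sum_congr rfl fun i _ => ?_
        rw [intervalIntegral.integral_mul_const, hpow, Nat.factorial_succ, mul_pow]
        push_cast
        have h1 : (i : ℝ) + 1 ≠ 0 := by positivity
        have h2 : (i.factorial : ℝ) ≠ 0 := by positivity
        field_simp
        ring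
      · simp
        ring

end

/-! ### Laplace transforms of laws on the half-line -/

theorem ae_prod_nonneg {ν ρ : Measure ℝ} [SFinite ρ] (hν : ∀ᵐ x ∂ν, 0 ≤ x)
    (hρ : ∀ᵐ x ∂ρ, 0 ≤ x) :
    ∀ᵐ p : ℝ × ℝ ∂ν.prod ρ, 0 ≤ p.1 + p.2 := by
  filter_upwards [Measure.quasiMeasurePreserving_fst.ae hν,
    Measure.quasiMeasurePreserving_snd.ae hρ] with p h1 h2
  exact add_nonneg h1 h2

section
variable {ν ρ : Measure ℝ} [IsProbabilityMeasure ν] [IsProbabilityMeasure ρ]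

/-- The product of the Laplace transforms of `ν` and `ρ` is the moment generating function of
minus the sum of independent variables with laws `ν` and `ρ`. -/
theorem laplaceTransform_mul :
    (fun s => laplaceTransform ν s * laplaceTransform ρ s) =
      mgf (fun p : ℝ × ℝ => -(p.1 + p.2)) (ν.prod ρ) := by
  ext s
  rw [laplaceTransform, laplaceTransform, ← integral_prod_mul, mgf]
  refine integral_congr_ae (ae_of_all _ fun p => ?_)
  simp only
  rw [← Real.exp_add]
  congr 1
  ring

theorem mem_interior_integrableExpSet (hν : ∀ᵐ x ∂ν, 0 ≤ x) (hρ : ∀ᵐ x ∂ρ, 0 ≤ x) {s : ℝ}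
    (hs : 0 < s) :
    s ∈ interior (integrableExpSet (fun p : ℝ × ℝ => -(p.1 + p.2)) (ν.prod ρ)) := by
  refine interior_maximal (fun t ht => ?_) isOpen_Ioi (Set.mem_Ioi.2 hs)
  have ht' : (0 : ℝ) < t := ht
  refine (integrable_const (1 : ℝ)).mono' (by fun_prop) ?_
  filter_upwards [ae_prod_nonneg hν hρ] with p hp
  rw [Real.norm_of_nonneg (Real.exp_pos _).le, Real.exp_le_one_iff]
  nlinarith

theorem contDiffAt_laplaceTransform_mul (hν : ∀ᵐ x ∂ν, 0 ≤ x) (hρ : ∀ᵐ x ∂ρ, 0 ≤ x) {s : ℝ}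
    (hs : 0 < s) :
    ContDiffAt ℝ ((⊤ : ℕ∞) : WithTop ℕ∞)
      (fun s => laplaceTransform ν s * laplaceTransform ρ s) s := by
  rw [laplaceTransform_mul]
  exact (analyticAt_mgf (mem_interior_integrableExpSet hν hρ hs)).contDiffAt

theorem iteratedDeriv_laplaceTransform_mul (hν : ∀ᵐ x ∂ν, 0 ≤ x) (hρ : ∀ᵐ x ∂ρ, 0 ≤ x) {s : ℝ}
    (hs : 0 < s) (i : ℕ) :
    Integrable (fun p : ℝ × ℝ => (p.1 + p.2) ^ i * Real.exp (-(s * (p.1 + p.2)))) (ν.prod ρ) ∧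
    iteratedDeriv i (fun s => laplaceTransform ν s * laplaceTransform ρ s) s =
      (-1) ^ i * ∫ p : ℝ × ℝ, (p.1 + p.2) ^ i * Real.exp (-(s * (p.1 + p.2))) ∂ν.prod ρ := by
  have hmem := mem_interior_integrableExpSet hν hρ hs
  have e : ∀ p : ℝ × ℝ, (p.1 + p.2) ^ i * Real.exp (-(s * (p.1 + p.2))) =
      (-1) ^ i * ((-(p.1 + p.2)) ^ i * Real.exp (s * -(p.1 + p.2))) := by
    intro p
    rw [← mul_assoc, ← mul_pow]
    ring_nf
  simp only [e]
  refine ⟨(integrable_pow_mul_exp_of_mem_interior_integrableExpSet hmem i).const_mul _, ?_⟩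
  rw [laplaceTransform_mul, iteratedDeriv_mgf hmem, integral_const_mul, ← mul_assoc, ← mul_pow]
  simp

/-- The right derivative at `0` of the Laplace transform of a law on `[0, ∞)` with finite mean. -/
theorem hasDerivWithinAt_laplaceTransform (hρ : ∀ᵐ x ∂ρ, 0 ≤ x)
    (hint : Integrable (fun x : ℝ => x) ρ) :
    HasDerivWithinAt (laplaceTransform ρ) (-∫ x, x ∂ρ) (Set.Ici 0) 0 := by
  have hexp : ∀ s : ℝ, 0 ≤ s → Integrable (fun x => Real.exp (-(s * x))) ρ := by
    intro s hs
    refine (integrable_const (1 : ℝ)).mono' (by fun_prop) ?_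
    filter_upwards [hρ] with x hx
    rw [Real.norm_of_nonneg (Real.exp_pos _).le, Real.exp_le_one_iff]
    nlinarith
  rw [hasDerivWithinAt_iff_tendsto_slope, Set.Ici_sdiff_left]
  have hlim : Tendsto (fun s : ℝ => ∫ x, s⁻¹ * (Real.exp (-(s * x)) - 1) ∂ρ) (𝓝[>] 0)
      (𝓝 (∫ x, -x ∂ρ)) := by
    refine tendsto_integral_filter_of_dominated_convergence (fun x => |x|)
      (Eventually.of_forall fun s => by fun_prop) ?_ hint.abs (ae_of_all _ fun x => ?_)
    · filter_upwards [self_mem_nhdsWithin] with s hs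
      have hs' : (0 : ℝ) < s := hs
      filter_upwards [hρ] with x hx
      have h1 : Real.exp (-(s * x)) ≤ 1 := Real.exp_le_one_iff.2 (by nlinarith)
      have h2 := Real.add_one_le_exp (-(s * x))
      rw [norm_mul, Real.norm_of_nonneg (inv_pos.2 hs').le, Real.norm_of_nonpos (by linarith),
        abs_of_nonneg hx, inv_mul_le_iff₀ hs']
      linarith
    · have hd : HasDerivAt (fun s : ℝ => Real.exp (-(s * x)))
          (Real.exp (-((0 : ℝ) * x)) * -(1 * x)) 0 :=
        ((hasDerivAt_id (0 : ℝ)).mul_const x).neg.exp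
      have := (hasDerivWithinAt_iff_tendsto_slope.1 (hd.hasDerivWithinAt (s := Set.Ioi 0)))
      rw [show Real.exp (-((0 : ℝ) * x)) * -(1 * x) = -x by simp,
        Set.sdiff_singleton_eq_self (by simp)] at this
      refine this.congr fun s => ?_
      rw [slope_def_field, div_eq_inv_mul]
      simp
  rw [integral_neg] at hlim
  refine hlim.congr' ?_
  filter_upwards [self_mem_nhdsWithin] with s hs
  have hs' : (0 : ℝ) < s := hs
  rw [integral_const_mul, integral_sub (hexp s hs'.le) (integrable_const 1), slope_def_field,
    div_eq_inv_mul]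
  simp [laplaceTransform]

end

/-! ### Positivity of the probabilities of extreme values -/

section
variable (r : ℝ) [hr : Fact (0 < r)]

theorem expMeasure_Iic_pos {c : ℝ} (hc : 0 < c) : 0 < expMeasure r (Set.Iic c) := by
  have h := cdf_expMeasure_eq hr.out c
  rw [cdf_eq_real, if_pos hc.le] at h
  refine (ENNReal.toReal_pos_iff.1 ?_).1
  rw [← measureReal_def]
  rw [h, sub_pos, Real.exp_lt_one_iff]
  exact neg_neg_of_pos (mul_pos hr.out hc)

theorem expMeasure_Ici_pos {c : ℝ} (hc : 0 ≤ c) : 0 < expMeasure r (Set.Ici c) := by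
  have h := cdf_expMeasure_eq hr.out c
  rw [cdf_eq_real, if_pos hc] at h
  have h2 := probReal_compl_eq_one_sub (μ := expMeasure r) (measurableSet_Iic (a := c))
  rw [h, Set.compl_Iic] at h2
  refine lt_of_lt_of_le (ENNReal.toReal_pos_iff.1 ?_).1
    (measure_mono (Set.Ioi_subset_Ici_self (a := c)))
  rw [← measureReal_def, h2]
  linarith [Real.exp_pos (-(r * c))]

/-- An Erlang variable is small with positive probability: each of its phases may be small. -/
theorem erlangMeasure_Iic_pos (n : ℕ) {c : ℝ} (hc : 0 < c) : 0 < erlangMeasure n r (Set.Iic c) := by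
  rw [erlangMeasure, Measure.map_apply (by fun_prop) measurableSet_Iic]
  have hc' : 0 < c / (n + 1) := by positivity
  refine lt_of_lt_of_le ?_ (measure_mono (s := Set.pi Set.univ fun _ => Set.Iic (c / (n + 1))) ?_)
  · rw [Measure.pi_pi]
    exact CanonicallyOrderedAdd.prod_pos.2 fun _ _ => expMeasure_Iic_pos r hc'
  · intro x hx
    have h1 : ∑ j, x j ≤ ∑ _j : Fin n, c / (n + 1) :=
      Finset.sum_le_sum fun j _ => hx j (Set.mem_univ j)
    simp only [Finset.sum_const, Finset.card_univ, Fintype.card_fin, nsmul_eq_mul] at h1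
    refine h1.trans ?_
    rw [mul_div_assoc', div_le_iff₀ (by positivity)]
    nlinarith

/-- An Erlang variable is large with positive probability: each of its phases may be large. -/
theorem erlangMeasure_Ici_pos {n : ℕ} (hn : 1 ≤ n) {c : ℝ} (hc : 0 ≤ c) :
    0 < erlangMeasure n r (Set.Ici c) := by
  rw [erlangMeasure, Measure.map_apply (by fun_prop) measurableSet_Ici]
  refine lt_of_lt_of_le ?_ (measure_mono (s := Set.pi Set.univ fun _ => Set.Ici c) ?_)
  · rw [Measure.pi_pi]
    exact CanonicallyOrderedAdd.prod_pos.2 fun _ _ => expMeasure_Ici_pos r hc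
  · intro x hx
    have h1 : ∑ _j : Fin n, c ≤ ∑ j, x j :=
      Finset.sum_le_sum fun j _ => hx j (Set.mem_univ j)
    simp only [Finset.sum_const, Finset.card_univ, Fintype.card_fin, nsmul_eq_mul] at h1
    have : (1 : ℝ) ≤ n := by exact_mod_cast hn
    exact (by nlinarith : c ≤ n * c).trans h1

end

/-! ### The law of the difference of preparation and service time -/

/-- The law of the difference `B - A` of independent variables with laws `ρ` for `A` and `β`
for `B`. -/
noncomputable def differenceLaw (ρ β : Measure ℝ) : Measure ℝ :=
  (ρ.prod β).map fun p => p.2 - p.1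

section
variable {ρ β : Measure ℝ} [IsProbabilityMeasure ρ] [IsProbabilityMeasure β]

instance isProbabilityMeasure_differenceLaw : IsProbabilityMeasure (differenceLaw ρ β) :=
  Measure.isProbabilityMeasure_map (by fun_prop)

theorem integrable_differenceLaw (hρ : Integrable (fun x : ℝ => x) ρ)
    (hβ : Integrable (fun x : ℝ => x) β) : Integrable (fun x : ℝ => x) (differenceLaw ρ β) := by
  rw [differenceLaw, integrable_map_measure (by fun_prop) (by fun_prop)]
  exact (hβ.comp_snd ρ).sub (hρ.comp_fst β)

theorem differenceLaw_Iic_pos (hρ : ∀ᵐ x ∂ρ, 0 ≤ x) {c : ℝ} (h : 0 < β (Set.Iic c)) :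
    0 < differenceLaw ρ β (Set.Iic c) := by
  rw [differenceLaw, Measure.map_apply (by fun_prop) measurableSet_Iic]
  refine lt_of_lt_of_le ?_ (measure_mono (s := Set.Ici 0 ×ˢ Set.Iic c) ?_)
  · rw [Measure.prod_prod, (mem_ae_iff_prob_eq_one measurableSet_Ici).1 hρ, one_mul]
    exact h
  · rintro ⟨a, b⟩ ⟨ha, hb⟩
    simp only [Set.mem_Ici, Set.mem_Iic, Set.mem_preimage] at *
    linarith

/-- `B - A ≥ c` has positive probability: `A` is at most some `M` with positive probability, and
`B` may exceed `M + c`. -/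
theorem differenceLaw_Ici_pos {c : ℝ} (hc : 0 ≤ c) (h : ∀ t : ℝ, 0 ≤ t → 0 < β (Set.Ici t)) :
    0 < differenceLaw ρ β (Set.Ici c) := by
  obtain ⟨M, hM⟩ : ∃ M : ℕ, 0 < ρ (Set.Iic (M : ℝ)) := by
    refine exists_measure_pos_of_not_measure_iUnion_null ?_
    rw [show ⋃ M : ℕ, Set.Iic (M : ℝ) = Set.univ from Set.eq_univ_of_forall fun x =>
      Set.mem_iUnion.2 (exists_nat_ge x)]
    simp
  rw [differenceLaw, Measure.map_apply (by fun_prop) measurableSet_Ici]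
  refine lt_of_lt_of_le ?_ (measure_mono (s := Set.Iic (M : ℝ) ×ˢ Set.Ici (M + c)) ?_)
  · rw [Measure.prod_prod]
    exact ENNReal.mul_pos hM.ne' (h _ (by positivity)).ne'
  · rintro ⟨a, b⟩ ⟨ha, hb⟩
    simp only [Set.mem_Ici, Set.mem_Iic, Set.mem_preimage] at *
    linarith

theorem integral_max_sub_differenceLaw (hρ : Integrable (fun x : ℝ => x) ρ)
    (hβ : Integrable (fun x : ℝ => x) β) (w : ℝ) :
    ∫ x, max 0 (x - w) ∂differenceLaw ρ β = ∫ a, ∫ b, max 0 (b - (w + a)) ∂β ∂ρ := by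
  have hm : AEStronglyMeasurable (fun x : ℝ => max 0 (x - w)) (differenceLaw ρ β) := by fun_prop
  have hd : AEMeasurable (fun p : ℝ × ℝ => p.2 - p.1) (ρ.prod β) := by fun_prop
  have hint : Integrable (fun x : ℝ => max 0 (x - w)) (differenceLaw ρ β) :=
    (integrable_const 0).sup ((integrable_differenceLaw hρ hβ).sub (integrable_const w))
  rw [differenceLaw] at hm hint ⊢
  rw [integrable_map_measure hm hd] at hint
  replace hint : Integrable (fun p : ℝ × ℝ => max 0 (p.2 - p.1 - w)) (ρ.prod β) := hint
  rw [integral_map hd hm, integral_prod _ hint]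
  congr with a
  congr with b
  congr 1
  ring

/-- If `A k`, `B k` are independent, the differences `B (k + 1) - A k` are i.i.d. -/
theorem hasLaw_differences {Ω : Type*} [MeasurableSpace Ω] {P : Measure Ω}
    {A B : ℕ → Ω → ℝ} (hA : ∀ k, HasLaw (A k) ρ P) (hB : ∀ k, HasLaw (B k) β P)
    (hindep : iIndepFun (Sum.elim A B) P) :
    HasLaw (fun ω k => B (k + 1) ω - A k ω)
      (Measure.infinitePi fun _ : ℕ => differenceLaw ρ β) P := by
  obtain ⟨μ, hμA, hμB⟩ : ∃ μ : ℕ → Bool → Measure ℝ, (∀ i, μ i false = ρ) ∧ ∀ i, μ i true = β :=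
    ⟨fun _ j => cond j β ρ, fun _ => rfl, fun _ => rfl⟩
  have : ∀ i j, IsProbabilityMeasure (μ i j) := by
    rintro i (_ | _)
    · rw [hμA]; infer_instance
    · rw [hμB]; infer_instance
  -- the `i`-th row of the array `A i`, `B (i + 1)` has law `infinitePi (μ i)`
  let e : ℕ × Bool → ℕ ⊕ ℕ := fun p => cond p.2 (Sum.inr (p.1 + 1)) (Sum.inl p.1)
  have he : Function.Injective e := by
    rintro ⟨i, _ | _⟩ ⟨j, _ | _⟩ h <;> simp_all [e]
  have hlaw : ∀ p : ℕ × Bool, HasLaw (Sum.elim A B (e p)) (μ p.1 p.2) P := by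
    rintro ⟨i, _ | _⟩
    · rw [hμA]; exact hA i
    · rw [hμB]; exact hB (i + 1)
  have h1 := (hindep.precomp he).hasLaw_infinitePi hlaw
    (aemeasurable_pi_iff.2 fun p => (hlaw p).aemeasurable)
  have h2 : HasLaw (MeasurableEquiv.curry ℕ Bool ℝ)
      (Measure.infinitePi fun i => Measure.infinitePi (μ i))
      (Measure.infinitePi fun p : ℕ × Bool => μ p.1 p.2) :=
    ⟨by fun_prop, Measure.infinitePi_map_curry μ⟩
  have hdiff : ∀ i, (Measure.infinitePi (μ i)).map (fun v : Bool → ℝ => v true - v false) =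
      differenceLaw ρ β := by
    intro i
    have hp := Measure.infinitePi_map_eval_prod (P := μ i) (i := false) (j := true) (by simp)
    rw [differenceLaw, ← hμA i, ← hμB i, ← hp,
      Measure.map_map (by fun_prop) (by fun_prop)]
    rfl
  have h3 : HasLaw (fun (u : ℕ → Bool → ℝ) k => u k true - u k false)
      (Measure.infinitePi fun _ : ℕ => differenceLaw ρ β)
      (Measure.infinitePi fun i => Measure.infinitePi (μ i)) := by
    refine ⟨by fun_prop, ?_⟩
    rw [Measure.infinitePi_map_pi (f := fun _ (v : Bool → ℝ) => v true - v false) _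
      fun _ => by fun_prop]
    simp only [hdiff]
  exact (h3.comp h2).comp h1

end

/-! ### The alternating service system -/

theorem waitingTime_eq_waitIter {Ω : Type*} (A B : ℕ → Ω → ℝ) (W₀ : Ω → ℝ) (k : ℕ) (ω : Ω) :
    waitingTime A B W₀ k ω = waitIter (fun i => B (i + 1) ω - A i ω) (W₀ ω) k := by
  induction k with
  | zero => rfl
  | succ k ih =>
    change max 0 (_ - waitingTime A B W₀ k ω) = _
    rw [ih]
    rfl

theorem aemeasurable_waitingTime {Ω : Type*} [MeasurableSpace Ω] {P : Measure Ω}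
    {A B : ℕ → Ω → ℝ} (hA : ∀ k, AEMeasurable (A k) P) (hB : ∀ k, AEMeasurable (B k) P)
    {W₀ : Ω → ℝ} (hW : AEMeasurable W₀ P) (k : ℕ) : AEMeasurable (waitingTime A B W₀ k) P := by
  induction k with
  | zero => exact hW
  | succ k ih => exact aemeasurable_const.max (((hB (k + 1)).sub (hA k)).sub ih)

/-- The part of the theorem that does not involve the Erlang distribution: if `ξ` is the law of
`X k = B (k + 1) - A k`, the limiting law exists, satisfies the mean stationarity equation, and
its mean is the almost sure limit of the Cesàro means of the waiting times. -/
theorem exists_limitingWaitingLaw {Ω : Type*} [MeasurableSpace Ω] {P : Measure Ω}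
    [IsProbabilityMeasure P] {ξ : Measure ℝ} [IsProbabilityMeasure ξ] {A B : ℕ → Ω → ℝ}
    (hA : ∀ k, AEMeasurable (A k) P) (hB : ∀ k, AEMeasurable (B k) P)
    (hX : HasLaw (fun ω k => B (k + 1) ω - A k ω) (iidLaw ξ) P)
    (hξ : Integrable (fun x : ℝ => x) ξ) {a : ℝ} (ha : 0 ≤ a) (h1 : 0 < ξ (Set.Iic a))
    (h2 : 0 < ξ (Set.Ici (2 * a))) :
    ∃ (ν : Measure ℝ) (_ : IsProbabilityMeasure ν),
      IsLimitingWaitingLaw P A B ν ∧ (∀ᵐ w ∂ν, 0 ≤ w) ∧ Integrable (fun w : ℝ => w) ν ∧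
      ∫ w, w ∂ν = ∫ w, (∫ y, max 0 (y - w) ∂ξ) ∂ν ∧
      ∀ W₀ : Ω → ℝ, IsInitialWaitingTime P W₀ → ∀ᵐ ω ∂P,
        Tendsto (fun k : ℕ => (∑ j ∈ Finset.range k, waitingTime A B W₀ j ω) / k) atTop
          (𝓝 (∫ w, w ∂ν)) := by
  obtain ⟨V, hVm, hV⟩ := exists_backIter_limit ξ ha h1 h2
  have hν : IsProbabilityMeasure ((iidLaw ξ).map V) :=
    Measure.isProbabilityMeasure_map hVm.aemeasurable
  have htransfer : ∀ {p : (ℕ → ℝ) → Prop}, (∀ᵐ x ∂iidLaw ξ, p x) →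
      ∀ᵐ ω ∂P, p fun k => B (k + 1) ω - A k ω := fun h =>
    ae_of_ae_map hX.aemeasurable (hX.map_eq.symm ▸ h)
  have hmean : ∫ w, w ∂(iidLaw ξ).map V = ∫ x, V x ∂iidLaw ξ :=
    integral_map hVm.aemeasurable (by fun_prop)
  refine ⟨(iidLaw ξ).map V, hν, ?_, ?_, ?_, ?_, ?_⟩
  · intro W₀ hW
    have hlim := tendstoInDistribution_waitIter hVm hV
    have hzero : TendstoInDistribution (waitingTime A B fun _ => 0) atTop id (fun _ => P)
        ((iidLaw ξ).map V) := by
      refine ⟨aemeasurable_waitingTime hA hB aemeasurable_const, aemeasurable_id, ?_⟩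
      have e : ∀ m, (iidLaw ξ).map (fun x => waitIter x 0 m) =
          P.map (waitingTime A B (fun _ => 0) m) := by
        intro m
        rw [← hX.map_eq, AEMeasurable.map_map_of_aemeasurable
          (measurable_waitIter 0 m).aemeasurable hX.aemeasurable]
        congr 1
        ext ω
        exact (waitingTime_eq_waitIter A B (fun _ => 0) m ω).symm
      have e' : (⟨((iidLaw ξ).map V).map id, Measure.isProbabilityMeasure_map aemeasurable_id⟩ :
          ProbabilityMeasure ℝ) = ⟨(iidLaw ξ).map V, hν⟩ := Subtype.ext Measure.map_id
      rw [e']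
      exact hlim.tendsto.congr fun m => Subtype.ext (e m)
    have hWm := aemeasurable_waitingTime hA hB hW.1
    refine tendstoInDistribution_of_tendstoInMeasure_sub _ _ hzero ?_ hWm
    refine tendstoInMeasure_of_tendsto_ae
      (fun k => ((hWm k).sub (hzero.forall_aemeasurable k)).aestronglyMeasurable) ?_
    filter_upwards [htransfer (ae_waitIter_eventually_eq ξ ha h1 h2), hW.2] with ω hω h0
    refine tendsto_const_nhds.congr' ?_
    filter_upwards [hω (W₀ ω) h0] with k hk
    simp [waitingTime_eq_waitIter, hk]
  · exact (ae_map_iff hVm.aemeasurable measurableSet_Ici).2 (ae_backIter_limit_nonneg hV)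
  · rw [integrable_map_measure (by fun_prop) hVm.aemeasurable]
    exact integrable_backIter_limit hξ hVm hV
  · rw [hmean, integral_map hVm.aemeasurable
      (continuous_integral_max_sub hξ).aestronglyMeasurable]
    exact integral_backIter_limit_eq hξ hV
  · intro W₀ hW
    filter_upwards [htransfer (ae_tendsto_cesaro_waitIter hξ hV), hW.2] with ω hω h0
    simp only [waitingTime_eq_waitIter, hmean]
    exact hω (W₀ ω) h0

/-- The mean of the limiting waiting time through the derivatives of the Laplace transform: the
stationarity equation makes it the mean excess of an Erlang variable over an independent `W + A`,
and the terms `E[(W + A) ^ i exp (-r (W + A))]` of that excess are derivatives of the transform. -/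
theorem mean_eq_sum_iteratedDeriv {ν ρ : Measure ℝ} [IsProbabilityMeasure ν]
    [IsProbabilityMeasure ρ] (hν : ∀ᵐ x ∂ν, 0 ≤ x) (hρ : ∀ᵐ x ∂ρ, 0 ≤ x)
    (hρi : Integrable (fun x : ℝ => x) ρ) (n : ℕ) (r : ℝ) [hr : Fact (0 < r)]
    (hstat : ∫ w, w ∂ν =
      ∫ w, (∫ y, max 0 (y - w) ∂differenceLaw ρ (erlangMeasure n r)) ∂ν) :
    ∫ w, w ∂ν = ∑ i ∈ Finset.range n, (-1 : ℝ) ^ i / (i.factorial : ℝ) *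
      iteratedDeriv i (fun s => laplaceTransform ν s * laplaceTransform ρ s) r *
      r ^ ((i : ℤ) - 1) * ((n : ℝ) - (i : ℝ)) := by
  have hr0 : r ≠ 0 := hr.out.ne'
  let c : ℕ → ℝ := fun i => r ^ i / (i.factorial : ℝ) * ((n - i) / r)
  let f : ℕ → ℝ × ℝ → ℝ := fun i p => (p.1 + p.2) ^ i * Real.exp (-(r * (p.1 + p.2)))
  have hD := iteratedDeriv_laplaceTransform_mul hν hρ hr.out
  have hf : ∀ i ∈ Finset.range n, Integrable (fun p => c i * f i p) (ν.prod ρ) := fun i _ =>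
    (hD i).1.const_mul (c i)
  have hinner : ∫ w, w ∂ν = ∫ w, ∫ a, ∑ i ∈ Finset.range n, c i * f i (w, a) ∂ρ ∂ν := by
    rw [hstat]
    refine integral_congr_ae ?_
    filter_upwards [hν] with w hw
    rw [integral_max_sub_differenceLaw hρi (integrable_erlangMeasure r n)]
    refine integral_congr_ae ?_
    filter_upwards [hρ] with x hx
    rw [integral_max_sub_erlangMeasure, if_neg (by linarith), Finset.mul_sum]
    refine Finset.sum_congr rfl fun i _ => ?_
    simp only [c, f]
    rw [mul_pow]
    ring
  rw [hinner, ← integral_prod (fun p => ∑ i ∈ Finset.range n, c i * f i p)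
    (integrable_finsetSum _ hf), integral_finsetSum _ hf]
  refine Finset.sum_congr rfl fun i _ => ?_
  rw [integral_const_mul, (hD i).2, zpow_sub_one₀ hr0, zpow_natCast]
  have hsq : (-1 : ℝ) ^ i * (-1) ^ i = 1 := by rw [← mul_pow]; simp
  simp only [c, f]
  linear_combination (-(r ^ i / (i.factorial : ℝ) * ((n - i) / r)) *
    ∫ p : ℝ × ℝ, (p.1 + p.2) ^ i * Real.exp (-(r * (p.1 + p.2))) ∂ν.prod ρ) * hsq

/-- In the stationary regime the server waits for a positive time on average. -/
theorem mean_pos_of_stationary {ν ξ : Measure ℝ} [IsProbabilityMeasure ν] [IsProbabilityMeasure ξ]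
    (hν : ∀ᵐ x ∂ν, 0 ≤ x) (hξ : Integrable (fun x : ℝ => x) ξ)
    (hlarge : ∀ c : ℝ, 0 ≤ c → 0 < ξ (Set.Ici c))
    (hνi : Integrable (fun x : ℝ => x) ν)
    (hstat : ∫ w, w ∂ν = ∫ w, (∫ y, max 0 (y - w) ∂ξ) ∂ν) : 0 < ∫ w, w ∂ν := by
  have hpos : ∀ w : ℝ, 0 ≤ w → 0 < ∫ y, max 0 (y - w) ∂ξ := by
    intro w hw
    rw [integral_pos_iff_support_of_nonneg (f := fun y => max 0 (y - w)) (fun y => le_max_left _ _)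
      (integrable_max_sub hξ w)]
    refine (hlarge (w + 1) (by linarith)).trans_le (measure_mono fun y hy => ?_)
    have : w + 1 ≤ y := hy
    exact (lt_max_of_lt_right (by linarith : 0 < y - w)).ne'
  refine (integral_nonneg_of_ae hν).lt_of_ne fun h0 => ?_
  -- a vanishing mean would force `W = 0` almost surely, hence a positive right-hand side
  have hz := (integral_eq_zero_iff_of_nonneg_ae hν hνi).1 h0.symm
  have hconst : ∫ w, (∫ y, max 0 (y - w) ∂ξ) ∂ν = ∫ _, (∫ y, max 0 (y - 0) ∂ξ) ∂ν := by
    refine integral_congr_ae ?_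
    filter_upwards [hz] with w hw
    rw [show w = 0 from hw]
  rw [hconst, ← h0] at hstat
  simp only [integral_const, probReal_univ, one_smul] at hstat
  exact (hpos 0 le_rfl).ne hstat

theorem mainTheorem2 {Ω : Type*} [MeasurableSpace Ω] (P : Measure Ω) [IsProbabilityMeasure P]
    (n : ℕ) (hn : 1 ≤ n) (μ : ℝ) (hμ : 0 < μ)
    (FA : Measure ℝ) [IsProbabilityMeasure FA]
    (hFA_nonneg : ∀ᵐ x ∂FA, 0 ≤ x) (hFA_mean : Integrable (fun x : ℝ => x) FA)
    (A B : ℕ → Ω → ℝ)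
    (hA : ∀ k, HasLaw (A k) FA P) (hB : ∀ k, HasLaw (B k) (erlangMeasure n μ) P)
    (hindep : iIndepFun (Sum.elim A B) P) :
    ∃ (ν : Measure ℝ) (_ : IsProbabilityMeasure ν) (θ : ℝ),
      IsLimitingWaitingLaw P A B ν ∧
      IsThroughput P A B θ ∧ 0 < θ ∧
      Integrable (fun x : ℝ => x) ν ∧
      θ⁻¹ = (∫ x, x ∂ν) + ∫ x, x ∂FA ∧
      ContDiffAt ℝ ((⊤ : ℕ∞) : WithTop ℕ∞)
        (fun s => laplaceTransform ν s * laplaceTransform FA s) μ ∧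
      DifferentiableWithinAt ℝ (laplaceTransform FA) (Set.Ici 0) 0 ∧
      (∫ x, x ∂ν) + ∫ x, x ∂FA =
        (∑ i ∈ Finset.range n,
          (-1 : ℝ) ^ i / (i.factorial : ℝ) *
            iteratedDeriv i (fun s => laplaceTransform ν s * laplaceTransform FA s) μ *
            μ ^ ((i : ℤ) - 1) * ((n : ℝ) - (i : ℝ))) -
          derivWithin (laplaceTransform FA) (Set.Ici 0) 0 := by
  have : Fact (0 < μ) := ⟨hμ⟩
  have hX := hasLaw_differences hA hB hindep
  have hξ := integrable_differenceLaw hFA_mean (integrable_erlangMeasure μ n)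
  have hlarge : ∀ c : ℝ, 0 ≤ c → 0 < differenceLaw FA (erlangMeasure n μ) (Set.Ici c) :=
    fun c hc => differenceLaw_Ici_pos hc fun t ht => erlangMeasure_Ici_pos μ hn ht
  obtain ⟨ν, hν, hlim, hν0, hνi, hstat, hces⟩ := exists_limitingWaitingLaw
    (fun k => (hA k).aemeasurable) (fun k => (hB k).aemeasurable) hX hξ zero_le_one
    (differenceLaw_Iic_pos hFA_nonneg (erlangMeasure_Iic_pos μ n one_pos))
    (hlarge _ (by norm_num))
  have hEW : 0 < ∫ x, x ∂ν := mean_pos_of_stationary hν0 hξ hlarge hνi hstat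
  have hEA : 0 ≤ ∫ x, x ∂FA := integral_nonneg_of_ae hFA_nonneg
  have hderiv := hasDerivWithinAt_laplaceTransform hFA_nonneg hFA_mean
  refine ⟨ν, hν, ((∫ x, x ∂ν) + ∫ x, x ∂FA)⁻¹, hlim, ?_, inv_pos.2 (by linarith), hνi,
    inv_inv _, contDiffAt_laplaceTransform_mul hν0 hFA_nonneg hμ,
    hderiv.differentiableWithinAt, ?_⟩
  · intro W₀ hW
    have hAlln := strong_law_ae_real A
      ((integrable_map_measure (g := fun x : ℝ => x) (by fun_prop) (hA 0).aemeasurable).1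
        ((hA 0).map_eq.symm ▸ hFA_mean))
      (fun i j hij => hindep.indepFun (i := Sum.inl i) (j := Sum.inl j) (by simpa using hij))
      (fun i => ⟨(hA i).aemeasurable, (hA 0).aemeasurable, (hA i).map_eq.trans (hA 0).map_eq.symm⟩)
    rw [(hA 0).integral_eq] at hAlln
    filter_upwards [hces W₀ hW, hAlln] with ω hω hω'
    refine ((hω.add hω').inv₀ (by linarith)).congr fun k => ?_
    rw [departureTime, Finset.sum_add_distrib, ← add_div, inv_div]
  · rw [hderiv.derivWithin (uniqueDiffOn_Ici 0 0 Set.self_mem_Ici), sub_neg_eq_add,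
      ← mean_eq_sum_iteratedDeriv hν0 hFA_nonneg hFA_mean n μ hstat]
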